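/- Let $d\ge 2$ be an integer, let $p\in\mathbb N\cup\{\infty\}$ (with $0\in\mathbb N$), and let $f:\mathbb R^d\to\mathbb R$ be a convex function of class $C^p$ which is not of class $C^{p+1}$ (where $C^{\infty+1}$ means real analytic). Then the following statements are equivalent: \begin{enumerate} \item $f$ is properly convex, that is, $f=\ell+c$, where $\ell:\mathbb R^d\to\mathbb R$ is linear and there are $-\infty<a<b\le\infty$ such that $c:\mathbb R^d\to[a,b)$ is convex and $c^{-1}([a,\beta])$ is compact for every $\beta\in[a,b)$. \item $f=\ell+c$ for some linear $\ell:\mathbb R^d\to\mathbb R$ and some $c:\mathbb R^d\to\mathbb R$ with $\lim_{|x|\to\infty}c(x)=\infty$. \item $f$ cannot be written in the form $f=c\circ P+\ell$ with $0\le k<d$, $P:\mathbb R^d\to\mathbb R^k$ a linear projection (a surjective linear map), $c:\mathbb R^k\to\mathbb R$ convex and $\ell:\mathbb R^d\to\mathbb R$ linear. \item $f$ can be approximated by strongly convex real-analytic functions in the $C^0$-fine topology, that is, for every continuous $\varepsilon:\mathbb R^d\to(0,\infty)$ there is a strongly convex real-analytic $g:\mathbb R^d\to\mathbb R$ with $|f(x)-g(x)|\le\varepsilon(x)$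 for all $x\in\mathbb R^d$. \item $f$ can be approximated by $C^{p+1}$ convex functions in the $C^0$-fine topology, that is, for every continuous $\varepsilon:\mathbb R^d\to(0,\infty)$ there is a convex $g:\mathbb R^d\to\mathbb R$ of class $C^{p+1}$ with $|f(x)-g(x)|\le\varepsilon(x)$ for all $x\in\mathbb R^d$. \end{enumerate} Here a $C^2$ function $\varphi$ on an open set $V\subseteq\mathbb R^d$ is called strongly convex if $\frac{d^2}{dt^2}\varphi(x+tv)\big|_{t=0}>0$ for all $x\in V$ and all $v\ne0$, and a function $g:\mathbb R^d\to\mathbb R$ is called strongly convex if every point of $\mathbb R^d$ has an open convex neighbourhood $V$ and a strongly convex $\varphi\in C^2(V)$ such that $g-\varphi$ is convex on $V$. -/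

import Mathlib

open Set Filter Topology
open scoped ContDiff

/-- The order of smoothness that follows `p ∈ ℕ ∪ {∞}`: it is `p + 1` for finite `p`, while
`C^{∞+1}` means real analytic. -/
def nextSmoothness : ℕ∞ → WithTop ℕ∞
  | (n : ℕ) => ((n + 1 : ℕ) : WithTop ℕ∞)
  | ⊤ => ω

/-- `f : ℝ^d → ℝ` is properly convex: `f = ℓ + c` with `ℓ` linear and
`c : ℝ^d → [a, b)`, `-∞ < a < b ≤ ∞`, convex and proper, the latter meaning that
`c⁻¹[a, β]` is compact for every `β ∈ [a, b)`. -/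
def IsProperlyConvex {d : ℕ} (f : EuclideanSpace ℝ (Fin d) → ℝ) : Prop :=
  ∃ (ℓ : EuclideanSpace ℝ (Fin d) →ₗ[ℝ] ℝ) (c : EuclideanSpace ℝ (Fin d) → ℝ)
    (a : ℝ) (b : EReal),
    (∀ x, f x = ℓ x + c x) ∧
    (a : EReal) < b ∧
    (∀ x, a ≤ c x ∧ (c x : EReal) < b) ∧
    ConvexOn ℝ univ c ∧
    ∀ β : ℝ, a ≤ β → (β : EReal) < b → IsCompact (c ⁻¹' Icc a β)

/-- A `C^2` function on an open set `V ⊆ ℝ^d` is strongly convex there if its second derivative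
along every nonconstant line is strictly positive at each point of the line lying in `V`. -/
def IsStronglyConvexC2On {d : ℕ} (V : Set (EuclideanSpace ℝ (Fin d)))
    (φ : EuclideanSpace ℝ (Fin d) → ℝ) : Prop :=
  ContDiffOn ℝ 2 φ V ∧
    ∀ x ∈ V, ∀ v : EuclideanSpace ℝ (Fin d), v ≠ 0 →
      0 < iteratedDeriv 2 (fun t : ℝ => φ (x + t • v)) 0

/-- A (not necessarily smooth) function `f : ℝ^d → ℝ` is strongly convex if every point has an
open (convex) neighbourhood `V` carrying a strongly convex `φ ∈ C^2(V)` with `f - φ` convex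
on `V`. -/
def IsStronglyConvex {d : ℕ} (f : EuclideanSpace ℝ (Fin d) → ℝ) : Prop :=
  ∀ p : EuclideanSpace ℝ (Fin d), ∃ V : Set (EuclideanSpace ℝ (Fin d)),
    IsOpen V ∧ p ∈ V ∧
      ∃ φ : EuclideanSpace ℝ (Fin d) → ℝ,
        IsStronglyConvexC2On V φ ∧ ConvexOn ℝ V (fun x => f x - φ x)

/-- `f` can be approximated in the `C^0`-fine topology by functions of the class `G`. -/
def IsFinelyApproximableBy {d : ℕ} (f : EuclideanSpace ℝ (Fin d) → ℝ)
    (G : Set (EuclideanSpace ℝ (Fin d) → ℝ)) : Prop :=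
  ∀ ε : EuclideanSpace ℝ (Fin d) → ℝ, Continuous ε → (∀ x, 0 < ε x) →
    ∃ g ∈ G, ∀ x, |f x - g x| ≤ ε x

/-! The pivot is coercivity modulo a linear function. If `f` is coercive and, after adding a
constant, nonnegative, take countably many affine functions `a i + b i` whose supremum exceeds `f`
everywhere, which stay below `f + ε`, and whose excess over `f` tends to zero uniformly. For weights
`lam i` growing fast, `∑' i, exp (lam i * (a i x + b i - s))` is analytic on `s > f x`, convex in
`(x, s)`, strictly decreasing in `s`, at most 1 at `s = f x + ε x` and at least 1 at some `s > f x`.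
Its level set 1 is therefore the graph of a convex `g` with `f < g ≤ f + ε`, analytic by the
implicit function theorem. Its Hessian is positive because coercivity prevents all the `a i` from
agreeing on a nonzero vector (`exists_analytic_approx`). The slopes of affine minorants of `f` form
a convex set. If it has interior, subtracting an interior slope makes `f` coercive; otherwise it
lies in a hyperplane, and `f` is affine along the normal and factors through fewer variables
(`exists_coercive_or_affine_direction`). Such a factorization is rigid: along a line in the kernel,
`g - f` is convex for each convex `g`, so if it is bounded and tends to zero it vanishes. Fine
approximation then forces `f = g`, against the failure of `C^{p+1}` smoothness
(`eq_of_factorization_of_abs_sub_le`). -/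

/-! ### Analyticity of weighted sums of exponentials -/

/-- The power series at `0` of `y ↦ ∑ i, w i * exp (A i y)`. -/
noncomputable def expSumSeries {ι V : Type*} [NormedAddCommGroup V] [NormedSpace ℝ V]
    (w : ι → ℝ) (A : ι → V →L[ℝ] ℝ) : FormalMultilinearSeries ℝ V ℝ := fun n =>
  ∑' i, (w i / n.factorial) •
    (ContinuousMultilinearMap.mkPiAlgebraFin ℝ n ℝ).compContinuousLinearMap (fun _ => A i)

section ExpSum

variable {ι V : Type*} [NormedAddCommGroup V] [NormedSpace ℝ V]
  {w : ι → ℝ} {A : ι → V →L[ℝ] ℝ} {r : ℝ}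

lemma norm_expSumSeries_term_le (hw : ∀ i, 0 ≤ w i) (n : ℕ) (i : ι) :
    ‖(w i / n.factorial) •
      (ContinuousMultilinearMap.mkPiAlgebraFin ℝ n ℝ).compContinuousLinearMap (fun _ => A i)‖
      ≤ w i * (‖A i‖ ^ n / n.factorial) := by
  have h := (ContinuousMultilinearMap.mkPiAlgebraFin ℝ n ℝ).norm_compContinuousLinearMap_le
    (fun _ => A i)
  rw [ContinuousMultilinearMap.norm_mkPiAlgebraFin, one_mul, Finset.prod_const,
    Finset.card_univ, Fintype.card_fin] at h
  rw [norm_smul, Real.norm_of_nonneg (div_nonneg (hw i) (Nat.cast_nonneg _))]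
  calc w i / n.factorial * _ ≤ w i / n.factorial * ‖A i‖ ^ n :=
        mul_le_mul_of_nonneg_left h (div_nonneg (hw i) (Nat.cast_nonneg _))
    _ = _ := by ring

lemma mul_pow_div_factorial_le_exp (hw : ∀ i, 0 ≤ w i) (hr : 0 < r) (n : ℕ) (i : ι) :
    w i * (‖A i‖ ^ n / n.factorial) * r ^ n ≤ w i * Real.exp (r * ‖A i‖) := by
  have := Real.pow_div_factorial_le_exp (r * ‖A i‖) (by positivity) n
  calc w i * (‖A i‖ ^ n / n.factorial) * r ^ n
      = w i * ((r * ‖A i‖) ^ n / n.factorial) := by rw [mul_pow]; ring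
    _ ≤ _ := mul_le_mul_of_nonneg_left this (hw i)

lemma summable_mul_pow_div_factorial (hw : ∀ i, 0 ≤ w i) (hr : 0 < r)
    (hs : Summable fun i => w i * Real.exp (r * ‖A i‖)) (n : ℕ) :
    Summable fun i => w i * (‖A i‖ ^ n / n.factorial) := by
  refine Summable.of_nonneg_of_le (fun i => mul_nonneg (hw i) (by positivity)) (fun i => ?_)
    (hs.mul_right ((r ^ n)⁻¹))
  rw [← div_eq_mul_inv, le_div_iff₀ (by positivity)]
  exact mul_pow_div_factorial_le_exp hw hr n i

lemma hasSum_expSumSeries_apply (hw : ∀ i, 0 ≤ w i) (hr : 0 < r)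
    (hs : Summable fun i => w i * Real.exp (r * ‖A i‖)) (n : ℕ) (y : V) :
    HasSum (fun i => w i * ((A i y) ^ n / n.factorial))
      (expSumSeries w A n fun _ => y) := by
  have h1 : Summable fun i => (w i / n.factorial) •
      (ContinuousMultilinearMap.mkPiAlgebraFin ℝ n ℝ).compContinuousLinearMap (fun _ => A i) :=
    Summable.of_norm_bounded (summable_mul_pow_div_factorial hw hr hs n)
      (norm_expSumSeries_term_le hw n)
  have h2 := ContinuousMultilinearMap.hasSum_eval h1.hasSum (fun _ => y)
  convert! h2 using 2 with i
  simp [List.ofFn_const]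
  ring

lemma norm_expSumSeries_le (hw : ∀ i, 0 ≤ w i) (hr : 0 < r)
    (hs : Summable fun i => w i * Real.exp (r * ‖A i‖)) (n : ℕ) :
    ‖expSumSeries w A n‖ * r ^ n ≤ ∑' i, w i * Real.exp (r * ‖A i‖) := by
  have h : ‖expSumSeries w A n‖ ≤ ∑' i, w i * (‖A i‖ ^ n / n.factorial) :=
    tsum_of_norm_bounded (summable_mul_pow_div_factorial hw hr hs n).hasSum
      (norm_expSumSeries_term_le hw n)
  calc ‖expSumSeries w A n‖ * r ^ n
      ≤ (∑' i, w i * (‖A i‖ ^ n / n.factorial)) * r ^ n := by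
        exact mul_le_mul_of_nonneg_right h (by positivity)
    _ = ∑' i, w i * (‖A i‖ ^ n / n.factorial) * r ^ n := tsum_mul_right.symm
    _ ≤ _ := ((summable_mul_pow_div_factorial hw hr hs n).mul_right _).tsum_le_tsum
        (mul_pow_div_factorial_le_exp hw hr n) hs

lemma hasSum_exp_pow (x : ℝ) : HasSum (fun n : ℕ => x ^ n / n.factorial) (Real.exp x) := by
  rw [Real.exp_eq_exp_ℝ]
  exact NormedSpace.expSeries_div_hasSum_exp x

/-- Expand each exponential and exchange the two sums; the double series is dominated by the
expansion of `∑ w i * exp (r * ‖A i‖)`, hence absolutely summable. -/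
lemma hasSum_expSumSeries (hw : ∀ i, 0 ≤ w i) (hr : 0 < r)
    (hs : Summable fun i => w i * Real.exp (r * ‖A i‖)) {y : V} (hy : ‖y‖ ≤ r) :
    HasSum (fun n => expSumSeries w A n fun _ => y) (∑' i, w i * Real.exp (A i y)) := by
  have hB : Summable fun q : ι × ℕ => w q.1 * ((r * ‖A q.1‖) ^ q.2 / q.2.factorial) := by
    have h0 : ∀ q : ι × ℕ, 0 ≤ w q.1 * ((r * ‖A q.1‖) ^ q.2 / q.2.factorial) :=
      fun q => mul_nonneg (hw _) (by positivity)
    have h1 : ∀ i, HasSum (fun n : ℕ => w i * ((r * ‖A i‖) ^ n / n.factorial))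
        (w i * Real.exp (r * ‖A i‖)) := fun i => (hasSum_exp_pow (r * ‖A i‖)).mul_left (w i)
    exact (summable_prod_of_nonneg h0).2
      ⟨fun i => (h1 i).summable, hs.congr fun i => (h1 i).tsum_eq.symm⟩
  have hT : Summable fun q : ι × ℕ => w q.1 * ((A q.1 y) ^ q.2 / q.2.factorial) := by
    refine Summable.of_norm_bounded hB fun q => ?_
    rw [norm_mul, Real.norm_of_nonneg (hw _), norm_div, norm_pow, Real.norm_natCast]
    have : ‖A q.1 y‖ ≤ r * ‖A q.1‖ :=
      ((A q.1).le_opNorm y).trans (by rw [mul_comm]; gcongr)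
    have := hw q.1
    gcongr
  have hT' : Summable fun q : ℕ × ι => w q.2 * ((A q.2 y) ^ q.1 / q.1.factorial) := hT.prod_symm
  have h1 : HasSum (fun i => w i * Real.exp (A i y)) _ :=
    hT.hasSum.prod_fiberwise fun i => (hasSum_exp_pow (A i y)).mul_left (w i)
  have h2 : HasSum (fun n => expSumSeries w A n fun _ => y) _ :=
    hT'.hasSum.prod_fiberwise fun n => hasSum_expSumSeries_apply hw hr hs n y
  have h3 : ∑' q : ℕ × ι, w q.2 * ((A q.2 y) ^ q.1 / q.1.factorial) =
      ∑' q : ι × ℕ, w q.1 * ((A q.1 y) ^ q.2 / q.2.factorial) :=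
    (Equiv.prodComm ℕ ι).tsum_eq fun q : ι × ℕ => w q.1 * ((A q.1 y) ^ q.2 / q.2.factorial)
  rw [h1.tsum_eq, ← h3]
  exact h2

lemma hasFPowerSeriesOnBall_expSum (hw : ∀ i, 0 ≤ w i) (hr : 0 < r)
    (hs : Summable fun i => w i * Real.exp (r * ‖A i‖)) (z : V) :
    HasFPowerSeriesOnBall (fun x => ∑' i, w i * Real.exp (A i (x - z))) (expSumSeries w A) z
      (ENNReal.ofReal r) where
  r_le := by
    lift r to NNReal using hr.le
    rw [ENNReal.ofReal_coe_nnreal]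
    exact (expSumSeries w A).le_radius_of_bound _ (norm_expSumSeries_le hw hr hs)
  r_pos := by simpa using hr
  hasSum := by
    intro y hy
    have hy' : ‖y‖ ≤ r := by
      rw [Metric.mem_eball, edist_zero_right, ← ofReal_norm,
        ENNReal.ofReal_lt_ofReal_iff hr] at hy
      exact hy.le
    simpa using hasSum_expSumSeries hw hr hs hy'

lemma analyticAt_expSum (hw : ∀ i, 0 ≤ w i) (hr : 0 < r)
    (hs : Summable fun i => w i * Real.exp (r * ‖A i‖)) (z : V) :
    AnalyticAt ℝ (fun x => ∑' i, w i * Real.exp (A i (x - z))) z :=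
  (hasFPowerSeriesOnBall_expSum hw hr hs z).analyticAt

lemma hasSum_fderiv_expSum (hw : ∀ i, 0 ≤ w i) (hr : 0 < r)
    (hs : Summable fun i => w i * Real.exp (r * ‖A i‖)) (z y : V) :
    HasSum (fun i => w i * A i y)
      (fderiv ℝ (fun x => ∑' i, w i * Real.exp (A i (x - z))) z y) := by
  have h := (hasFPowerSeriesOnBall_expSum hw hr hs z).hasFPowerSeriesAt.fderiv_eq
  have h1 := hasSum_expSumSeries_apply hw hr hs 1 y
  have hy : (![y] : Fin 1 → V) = fun _ => y := by ext i; simp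
  rw [h]
  simpa [hy] using h1

end ExpSum

/-! ### Second derivatives as limits of symmetric differences -/

/-- Second order symmetric difference quotients converge to the second derivative. -/
lemma isLittleO_second_difference {u : ℝ → ℝ} {δ : ℝ} (hδ : 0 < δ)
    (hu : ContDiffOn ℝ 2 u (Ioo (-δ) δ)) :
    (fun t => u t + u (-t) - 2 * u 0 - iteratedDeriv 2 u 0 * t ^ 2) =o[𝓝 0] fun t => t ^ 2 := by
  have h0 : (0 : ℝ) ∈ Ioo (-δ) δ := ⟨by linarith, hδ⟩
  have hnhds : Ioo (-δ) δ ∈ 𝓝 (0 : ℝ) := isOpen_Ioo.mem_nhds h0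
  have h := taylor_isLittleO (n := 2) (convex_Ioo (-δ) δ) h0 (by exact_mod_cast hu)
  rw [nhdsWithin_eq_nhds.2 hnhds] at h
  have hneg : Tendsto (fun t : ℝ => -t) (𝓝 0) (𝓝 0) := by
    simpa using (continuous_neg (G := ℝ)).tendsto 0
  have h' := h.comp_tendsto hneg
  have hid : iteratedDerivWithin 2 u (Ioo (-δ) δ) 0 = iteratedDeriv 2 u 0 :=
    iteratedDerivWithin_of_isOpen isOpen_Ioo h0
  have h2 := h.add (h'.congr_right (g₂ := fun t : ℝ => (t - 0) ^ 2) (fun t => by simp))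
  refine (h2.congr (fun t => ?_) (fun t => by simp))
  simp only [Function.comp, taylorWithinEval_succ, taylor_within_zero_eval, hid]
  simp
  ring

lemma tendsto_second_difference {u : ℝ → ℝ} {δ : ℝ} (hδ : 0 < δ)
    (hu : ContDiffOn ℝ 2 u (Ioo (-δ) δ)) :
    Tendsto (fun t => (u t + u (-t) - 2 * u 0) / t ^ 2) (𝓝[≠] 0)
      (𝓝 (iteratedDeriv 2 u 0)) := by
  have h1 := (isLittleO_second_difference hδ hu).tendsto_div_nhds_zero
  have h2 := (h1.mono_left (nhdsWithin_le_nhds (s := {0}ᶜ))).add_const (iteratedDeriv 2 u 0)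
  rw [zero_add] at h2
  refine h2.congr' ?_
  filter_upwards [self_mem_nhdsWithin] with t ht
  have : t ≠ 0 := ht
  field_simp
  ring

/-! ### The function defined implicitly by `expSum = 1` -/

/-- The exponential sum `∑ i, exp (lam i * (a i x + b i - s))` as a function of `(x, s)`. -/
noncomputable def expSum {ι E : Type*} [NormedAddCommGroup E] [NormedSpace ℝ E]
    (a : ι → E →L[ℝ] ℝ) (b lam : ι → ℝ) (z : E × ℝ) : ℝ :=
  ∑' i, Real.exp (lam i * (a i z.1 + b i - z.2))

/-- The affine functions `a i + b i` exceed `f` by amounts tending to zero, their supremum is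
everywhere larger than `f`, and the weights `lam i` grow fast. -/
structure IsSharpAffineFamily {ι E : Type*} [NormedAddCommGroup E] [NormedSpace ℝ E]
    (f : E → ℝ) (a : ι → E →L[ℝ] ℝ) (b lam : ι → ℝ) : Prop where
  pos : ∀ i, 0 < lam i
  summable : ∀ c : ℝ, 0 < c → Summable fun i => Real.exp (-(c * lam i))
  le_add : ∀ δ : ℝ, 0 < δ → ∀ᶠ i in cofinite, ∀ x, a i x + b i ≤ f x + δ
  exists_lt : ∀ x, ∃ i, f x < a i x + b i

section

variable {ι E : Type*} [NormedAddCommGroup E] [NormedSpace ℝ E]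
  {f : E → ℝ} {a : ι → E →L[ℝ] ℝ} {b lam : ι → ℝ}

/-- The linear part of the `i`-th exponent of `expSum`. -/
noncomputable def expSlope (a : ι → E →L[ℝ] ℝ) (lam : ι → ℝ) (i : ι) : E × ℝ →L[ℝ] ℝ :=
  lam i • ((a i).comp (ContinuousLinearMap.fst ℝ E ℝ) - ContinuousLinearMap.snd ℝ E ℝ)

lemma expSlope_apply (i : ι) (z : E × ℝ) : expSlope a lam i z = lam i * (a i z.1 - z.2) := by
  simp [expSlope]

lemma norm_expSlope_le {i : ι} (h : 0 ≤ lam i) : ‖expSlope a lam i‖ ≤ lam i * (‖a i‖ + 1) := by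
  refine ContinuousLinearMap.opNorm_le_bound _ (by positivity) fun z => ?_
  rw [expSlope_apply, norm_mul, Real.norm_of_nonneg h, mul_assoc]
  refine mul_le_mul_of_nonneg_left ?_ h
  calc ‖a i z.1 - z.2‖ ≤ ‖a i z.1‖ + ‖z.2‖ := norm_sub_le _ _
    _ ≤ ‖a i‖ * ‖z‖ + ‖z‖ := by
        gcongr
        · exact ((a i).le_opNorm _).trans (by gcongr; exact norm_fst_le z)
        · exact norm_snd_le z
    _ = _ := by ring

lemma mul_opNorm_le_of_forall_closedBall {l : E →L[ℝ] ℝ} {x₀ : E} {r β C : ℝ} (hr : 0 < r)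
    (h : ∀ y ∈ Metric.closedBall x₀ r, l y + β ≤ C) : r * ‖l‖ ≤ C - (l x₀ + β) := by
  rw [mul_comm, ← le_div_iff₀ hr]
  have h0 := h x₀ (Metric.mem_closedBall_self hr.le)
  refine ContinuousLinearMap.opNorm_le_of_unit_norm (div_nonneg (by linarith) hr.le)
    fun y hy => ?_
  have key : ∀ t : ℝ, |t| = r → t * l y ≤ C - (l x₀ + β) := fun t ht => by
    have := h (x₀ + t • y) (by simp [norm_smul, hy, ht])
    simp only [map_add, map_smul, smul_eq_mul] at this
    linarith
  have h1 := key r (abs_of_pos hr)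
  have h2 := key (-r) (by rw [abs_neg, abs_of_pos hr])
  rw [Real.norm_eq_abs, abs_le, le_div_iff₀ hr, neg_le, le_div_iff₀ hr]
  constructor <;> linarith

namespace IsSharpAffineFamily

variable (h : IsSharpAffineFamily f a b lam)
include h

/-- An affine function below `f + δ` on a ball has its slope controlled by its value at the centre.
So even steep `a i` cost nothing: what the factor `exp (r * ‖expSlope a lam i‖)` adds is absorbed by
how far `a i x + b i` lies below `s`. -/
lemma exists_summable_mul_exp_norm (hf : Continuous f) {x : E} {s : ℝ} (hs : f x < s) :
    ∃ r > 0, Summable fun i =>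
      Real.exp (lam i * (a i x + b i - s)) * Real.exp (r * ‖expSlope a lam i‖) := by
  -- One quarter each for the oscillation of `f` near `x`, the excess of `a i + b i` over `f`, and
  -- the bound `r ≤ δ`; the last leaves the summable majorant `exp (-(δ * lam i))`.
  set δ := (s - f x) / 4 with hδ
  have hδ0 : 0 < δ := by linarith
  have h1 : ∀ᶠ y in 𝓝 x, f y < f x + δ := hf.continuousAt.eventually_lt_const (by linarith)
  obtain ⟨r₁, hr₁, hr₁'⟩ := Metric.eventually_nhds_iff_ball.1 h1
  set r := min (r₁ / 2) δ with hr
  have hr0 : 0 < r := lt_min (by linarith) hδ0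
  refine ⟨r, hr0, ?_⟩
  refine Summable.of_norm_bounded_eventually (h.summable δ hδ0) ?_
  filter_upwards [h.le_add δ hδ0] with i hi
  rw [← Real.exp_add, Real.norm_of_nonneg (Real.exp_pos _).le, Real.exp_le_exp]
  have hb : r * ‖a i‖ ≤ f x + δ + δ - (a i x + b i) := by
    refine mul_opNorm_le_of_forall_closedBall hr0 fun y hy => ?_
    have := hr₁' y (Metric.closedBall_subset_ball
      ((min_le_left _ _).trans_lt (by linarith)) hy)
    linarith [hi y]
  have hn := mul_le_mul_of_nonneg_left (norm_expSlope_le (a := a) (h.pos i).le) hr0.le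
  have : r ≤ δ := min_le_right _ _
  have h3 : lam i * (a i x + b i - s + (r * ‖a i‖ + r)) ≤ lam i * (-δ) :=
    mul_le_mul_of_nonneg_left (by linarith) (h.pos i).le
  linarith

lemma summable_exp (hf : Continuous f) {x : E} {s : ℝ} (hs : f x < s) :
    Summable fun i => Real.exp (lam i * (a i x + b i - s)) := by
  obtain ⟨r, hr, hsum⟩ := h.exists_summable_mul_exp_norm hf hs
  refine Summable.of_nonneg_of_le (fun i => (Real.exp_pos _).le) (fun i => ?_) hsum
  exact le_mul_of_one_le_right (Real.exp_pos _).le (Real.one_le_exp (by positivity))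

omit h in
lemma expSum_eq (x : E) (s : ℝ) : expSum a b lam = fun z =>
    ∑' i, Real.exp (lam i * (a i x + b i - s)) * Real.exp (expSlope a lam i (z - (x, s))) := by
  funext z
  refine tsum_congr fun i => ?_
  rw [← Real.exp_add, expSlope_apply]
  congr 1
  simp only [Prod.fst_sub, Prod.snd_sub, map_sub]
  ring

lemma analyticAt_expSum (hf : Continuous f) {x : E} {s : ℝ} (hs : f x < s) :
    AnalyticAt ℝ (expSum a b lam) (x, s) := by
  obtain ⟨r, hr, hsum⟩ := h.exists_summable_mul_exp_norm hf hs
  rw [expSum_eq x s]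
  exact _root_.analyticAt_expSum (fun i => (Real.exp_pos _).le) hr hsum _

lemma hasSum_fderiv_expSum (hf : Continuous f) {x : E} {s : ℝ} (hs : f x < s) (y : E × ℝ) :
    HasSum (fun i => Real.exp (lam i * (a i x + b i - s)) * (lam i * (a i y.1 - y.2)))
      (fderiv ℝ (expSum a b lam) (x, s) y) := by
  obtain ⟨r, hr, hsum⟩ := h.exists_summable_mul_exp_norm hf hs
  rw [expSum_eq x s]
  simpa only [expSlope_apply] using
    _root_.hasSum_fderiv_expSum (fun i => (Real.exp_pos _).le) hr hsum (x, s) y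

lemma summable_exp_mul (hf : Continuous f) {x : E} {s : ℝ} (hs : f x < s) :
    Summable fun i => Real.exp (lam i * (a i x + b i - s)) * lam i := by
  -- The series is the derivative of `expSum` in the direction `(0, -1)`.
  simpa using (h.hasSum_fderiv_expSum hf hs (0, -1)).summable

lemma fderiv_expSum_neg (hf : Continuous f) {x : E} {s : ℝ} (hs : f x < s) :
    fderiv ℝ (expSum a b lam) (x, s) (0, 1) < 0 := by
  have h1 := h.hasSum_fderiv_expSum hf hs (0, 1)
  -- Only the nonemptiness of `ι` matters here: one strict term makes the sum strict.
  obtain ⟨i, -⟩ := h.exists_lt x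
  have hneg : ∀ j, Real.exp (lam j * (a j x + b j - s)) *
      (lam j * (a j ((0, 1) : E × ℝ).1 - ((0, 1) : E × ℝ).2)) < 0 := fun j => by
    have := mul_pos (Real.exp_pos (lam j * (a j x + b j - s))) (h.pos j)
    simpa using this
  simpa using hasSum_lt (fun j => (hneg j).le) (hneg i) h1 hasSum_zero

lemma expSum_lt_expSum (hf : Continuous f) {x : E} {s t : ℝ} (hs : f x < s) (hst : s < t) :
    expSum a b lam (x, t) < expSum a b lam (x, s) := by
  obtain ⟨i, -⟩ := h.exists_lt x
  have hlt : ∀ j, Real.exp (lam j * (a j x + b j - t)) < Real.exp (lam j * (a j x + b j - s)) :=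
    fun j => Real.exp_lt_exp.2 (mul_lt_mul_of_pos_left (by linarith) (h.pos j))
  exact (h.summable_exp hf (hs.trans hst)).tsum_lt_tsum (fun j => (hlt j).le) (hlt i)
    (h.summable_exp hf hs)

/-- The level set `expSum = 1` is the graph of a function lying between `f` and `F`. -/
lemma exists_expSum_eq_one (hf : Continuous f) {F : E → ℝ}
    (hF : ∀ x, expSum a b lam (x, F x) ≤ 1) (haF : ∀ i x, a i x + b i ≤ F x) :
    ∃ g : E → ℝ, ∀ x, f x < g x ∧ g x ≤ F x ∧ expSum a b lam (x, g x) = 1 := by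
  refine ⟨_, fun x => Classical.choose_spec
    (p := fun s => f x < s ∧ s ≤ F x ∧ expSum a b lam (x, s) = 1) ?_⟩
  obtain ⟨i, hi⟩ := h.exists_lt x
  have hcont : ContinuousOn (fun s => expSum a b lam (x, s)) (Icc (a i x + b i) (F x)) :=
    fun s hs => by
      have h1 := (h.analyticAt_expSum hf (hi.trans_le hs.1)).continuousAt
      have h2 : ContinuousAt (fun s : ℝ => (x, s)) s := by fun_prop
      exact (ContinuousAt.comp (f := fun s : ℝ => (x, s)) h1 h2).continuousWithinAt
  have h1 : 1 ≤ expSum a b lam (x, a i x + b i) := by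
    have := (h.summable_exp hf hi).le_tsum i fun j _ => (Real.exp_pos _).le
    simpa [expSum] using this
  obtain ⟨s, hs, hs1⟩ := intermediate_value_Icc' (haF i x) hcont ⟨hF x, h1⟩
  exact ⟨s, hi.trans_le hs.1, hs.2, hs1⟩

/-- If `g` rose above a chord, then at the chord's height, still above `f`, strict decrease in `s`
would give `expSum > 1`, while convexity of `exp` gives `expSum ≤ 1`. -/
lemma convexOn_of_expSum_eq_one (hf : Continuous f) (hfc : ConvexOn ℝ univ f) {g : E → ℝ}
    (hfg : ∀ x, f x < g x) (hg : ∀ x, expSum a b lam (x, g x) = 1) : ConvexOn ℝ univ g := by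
  refine ⟨convex_univ, fun x _ y _ α β hα hβ hαβ => ?_⟩
  by_contra! hlt
  have hfs : f (α • x + β • y) < α • g x + β • g y := by
    refine (hfc.2 (mem_univ x) (mem_univ y) hα hβ hαβ).trans_lt ?_
    simp only [smul_eq_mul]
    rcases hα.eq_or_lt with rfl | hα'
    · have : β = 1 := by linarith
      simpa [this] using hfg y
    · exact add_lt_add_of_lt_of_le (mul_lt_mul_of_pos_left (hfg x) hα')
        (mul_le_mul_of_nonneg_left (hfg y).le hβ)
  have h1 := h.expSum_lt_expSum hf hfs hlt
  rw [hg] at h1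
  have h2 : expSum a b lam (α • x + β • y, α • g x + β • g y) ≤
      α * expSum a b lam (x, g x) + β * expSum a b lam (y, g y) := by
    have sx := (h.summable_exp hf (hfg x)).mul_left α
    have sy := (h.summable_exp hf (hfg y)).mul_left β
    simp only [expSum]
    rw [← tsum_mul_left, ← tsum_mul_left, ← sx.tsum_add sy]
    refine (h.summable_exp hf hfs).tsum_le_tsum (fun i => ?_) (sx.add sy)
    have := convexOn_exp.2 (mem_univ (lam i * (a i x + b i - g x)))
      (mem_univ (lam i * (a i y + b i - g y))) hα hβ hαβ
    simp only [smul_eq_mul] at this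
    convert! this using 2
    simp only [map_add, map_smul, smul_eq_mul]
    linear_combination (- lam i * b i) * hαβ
  rw [hg, hg] at h2
  linarith

variable [CompleteSpace E]

lemma analyticAt_of_expSum_eq_one (hf : Continuous f) {g : E → ℝ} (hgc : Continuous g)
    (hfg : ∀ x, f x < g x) (hg : ∀ x, expSum a b lam (x, g x) = 1) (x : E) :
    AnalyticAt ℝ g x := by
  have hΦ : ContDiffAt ℝ ω (expSum a b lam) (x, g x) :=
    (h.analyticAt_expSum hf (hfg x)).contDiffAt
  have hne := (h.fderiv_expSum_neg hf (hfg x)).ne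
  have hinv : (fderiv ℝ (expSum a b lam) (x, g x) ∘L .inr ℝ E ℝ).IsInvertible := by
    refine ⟨ContinuousLinearEquiv.unitsEquivAut ℝ (Units.mk0 _ hne), ?_⟩
    ext
    simp
  have hω : (ω : WithTop ℕ∞) ≠ 0 := by simp
  refine (ContDiffAt.congr_of_eventuallyEq (hΦ.contDiffAt_implicitFunction hω hinv) ?_).analyticAt
  have hev := hΦ.eventually_apply_eq_iff_implicitFunction hω hinv
  have hcont : Tendsto (fun y => (y, g y)) (𝓝 x) (𝓝 (x, g x)) :=
    (continuous_id.prodMk hgc).tendsto x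
  filter_upwards [hcont.eventually hev] with y hy
  exact (hy.1 (by rw [hg, hg])).symm

end IsSharpAffineFamily

end

/-! ### Positivity of the Hessian -/

lemma Real.one_add_sq_div_two_le_cosh (y : ℝ) : 1 + y ^ 2 / 2 ≤ Real.cosh y := by
  have h1 : Real.cosh y = 1 + 2 * Real.sinh (y / 2) ^ 2 := by
    have h2 := Real.cosh_two_mul (y / 2)
    have h3 := Real.cosh_sq (y / 2)
    rw [show 2 * (y / 2) = y by ring] at h2
    linarith
  have h4 : (y / 2) ^ 2 ≤ Real.sinh (y / 2) ^ 2 := by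
    rcases le_total 0 (y / 2) with h | h
    · exact pow_le_pow_left₀ h (Real.self_le_sinh_iff.2 h) 2
    · have := pow_le_pow_left₀ (neg_nonneg.2 h) (neg_le_neg (Real.sinh_le_self_iff.2 h)) 2
      simpa using this
  rw [h1]
  linarith

section

variable {ι E : Type*} [NormedAddCommGroup E] [NormedSpace ℝ E]
  {f : E → ℝ} {a : ι → E →L[ℝ] ℝ} {b lam : ι → ℝ}

namespace IsSharpAffineFamily

variable (h : IsSharpAffineFamily f a b lam)
include h

/-- A lower bound for the symmetric second difference of the function defined implicitly by
`expSum = 1`. -/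
lemma sq_le_second_difference (hf : Continuous f) {g : E → ℝ}
    (hfg : ∀ x, f x < g x) (hg : ∀ x, expSum a b lam (x, g x) = 1) (x v : E) (k : ι) (t : ℝ) :
    Real.exp (lam k * (a k x + b k - g x)) * lam k ^ 2 *
        (Real.exp (-(lam k * ((g (x + t • v) + g (x + (-t) • v) - 2 * g x) / 2))) *
          (t * a k v - (g (x + t • v) - g (x + (-t) • v)) / 2) ^ 2) ≤
      (∑' i, Real.exp (lam i * (a i x + b i - g x)) * lam i) *
        (g (x + t • v) + g (x + (-t) • v) - 2 * g x) := by
  classical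
  set s₁ := g (x + t • v) with hs₁
  set s₂ := g (x + (-t) • v) with hs₂
  set q := s₁ + s₂ - 2 * g x with hq
  set d := (s₁ - s₂) / 2 with hd
  set w : ι → ℝ := fun i => Real.exp (lam i * (a i x + b i - g x)) with hw
  set X := w k * lam k ^ 2 * (Real.exp (-(lam k * (q / 2))) * (t * a k v - d) ^ 2) / 2 with hX
  have hsum : ∀ y, HasSum (fun i => Real.exp (lam i * (a i y + b i - g y))) 1 := fun y => by
    rw [← hg y]
    exact (h.summable_exp hf (hfg y)).hasSum
  have h1 := ((hsum (x + t • v)).add (hsum (x + (-t) • v))).div_const 2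
  have h2 := ((hsum x).sub (((h.summable_exp_mul hf (hfg x)).hasSum).mul_right (q / 2))).add
    (hasSum_ite_eq k X)
  have h3 := hasSum_le (fun i => ?_) h2 h1
  · change w k * lam k ^ 2 * _ ≤ (∑' i, w i * lam i) * q
    change 1 - (∑' i, w i * lam i) * (q / 2) + X ≤ (1 + 1) / 2 at h3
    linarith
  -- The terms at `x ± t • v` are `exp (P ± Y)`, with mean `exp P * cosh Y`. The bound `exp z ≥ 1 +
  -- z` handles `exp P`, and the gain `Y ^ 2 / 2` from `cosh` is kept only for `i = k`; after
  -- summation the total masses 1 cancel.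
  · set P := lam i * (a i x + b i - g x) - lam i * (q / 2) with hP
    set Y := lam i * (t * a i v - d) with hY
    have e1 : lam i * (a i (x + t • v) + b i - g (x + t • v)) = P + Y := by
      simp only [map_add, map_smul, smul_eq_mul, ← hs₁, hP, hY, hq, hd]; ring
    have e2 : lam i * (a i (x + (-t) • v) + b i - g (x + (-t) • v)) = P + -Y := by
      simp only [map_add, map_smul, smul_eq_mul, ← hs₂, hP, hY, hq, hd]; ring
    have e3 : (Real.exp (P + Y) + Real.exp (P + -Y)) / 2 = Real.exp P * Real.cosh Y := by
      rw [Real.exp_add, Real.exp_add, Real.cosh_eq]; ring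
    have e4 : Real.exp P = w i * Real.exp (-(lam i * (q / 2))) := by
      rw [hw, ← Real.exp_add, hP]; ring_nf
    have hwi : 0 < w i := Real.exp_pos _
    have e5 : w i - w i * lam i * (q / 2) ≤ Real.exp P := by
      rw [e4]
      have := mul_le_mul_of_nonneg_left (Real.add_one_le_exp (-(lam i * (q / 2)))) hwi.le
      linarith
    have e6 : (if i = k then X else 0) ≤ Real.exp P * (Y ^ 2 / 2) := by
      split_ifs with hik
      · subst hik
        rw [e4, hX, hY]
        apply le_of_eq; ring
      · positivity
    have e7 := mul_le_mul_of_nonneg_left (Real.one_add_sq_div_two_le_cosh Y) (Real.exp_pos P).le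
    change w i - w i * lam i * (q / 2) + _ ≤ (Real.exp (lam i * (a i (x + t • v) + b i -
      g (x + t • v))) + Real.exp (lam i * (a i (x + (-t) • v) + b i - g (x + (-t) • v)))) / 2
    rw [e1, e2, e3]
    linarith

/-- Dividing `sq_le_second_difference` by `t ^ 2` and letting `t → 0` bounds `L` times the second
derivative below by a positive multiple of `(a k v - deriv u 0) ^ 2`; `k` is chosen to make this
nonzero. -/
lemma iteratedDeriv_two_pos (hf : Continuous f) {g : E → ℝ} (hg2 : ContDiff ℝ 2 g)
    (hfg : ∀ x, f x < g x) (hg : ∀ x, expSum a b lam (x, g x) = 1)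
    {v : E} (hv : ∀ α : ℝ, ∃ i, a i v ≠ α) (x : E) :
    0 < iteratedDeriv 2 (fun t : ℝ => g (x + t • v)) 0 := by
  set u : ℝ → ℝ := fun t => g (x + t • v) with hu
  have hu2 : ContDiff ℝ 2 u := hg2.comp (by fun_prop)
  have hu0 : u 0 = g x := by simp [hu]
  obtain ⟨k, hk⟩ := hv (deriv u 0)
  set L := ∑' i, Real.exp (lam i * (a i x + b i - g x)) * lam i with hL
  have hLpos : 0 < L := (h.summable_exp_mul hf (hfg x)).tsum_pos
    (fun i => mul_nonneg (Real.exp_pos _).le (h.pos i).le) k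
    (mul_pos (Real.exp_pos _) (h.pos k))
  have hq : Tendsto (fun t => (u t + u (-t) - 2 * g x) / t ^ 2) (𝓝[≠] 0)
      (𝓝 (iteratedDeriv 2 u 0)) := by
    simpa only [hu0] using tendsto_second_difference one_pos hu2.contDiffOn
  have hd : Tendsto (fun t => (u t - u (-t)) / 2 / t) (𝓝[≠] 0) (𝓝 (deriv u 0)) := by
    have hder : HasDerivAt u (deriv u 0) 0 :=
      (hu2.differentiable (by norm_num)).differentiableAt.hasDerivAt
    have hder' : HasDerivAt (fun t => (u t - u (-t)) / 2) (deriv u 0) 0 := by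
      have h1 : HasDerivAt (fun t => u (-t)) (-deriv u 0) 0 := by
        have h0 : HasDerivAt u (deriv u 0) (-0) := by rw [neg_zero]; exact hder
        simpa [Function.comp_def] using h0.scomp 0 (hasDerivAt_neg (0 : ℝ))
      convert! (hder.sub h1).div_const 2 using 1
      ring
    have := hder'.tendsto_slope_zero
    refine this.congr fun t => ?_
    simp
    ring
  have hq0 : Tendsto (fun t => u t + u (-t) - 2 * g x) (𝓝[≠] 0) (𝓝 0) := by
    have hc : Continuous fun t => u t + u (-t) - 2 * g x := by
      have := hu2.continuous
      fun_prop
    have := (hc.tendsto 0).mono_left (nhdsWithin_le_nhds (s := {0}ᶜ))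
    simpa [hu0, two_mul] using this
  set W := Real.exp (lam k * (a k x + b k - g x)) * lam k ^ 2 with hW
  have hWpos : 0 < W := mul_pos (Real.exp_pos _) (pow_pos (h.pos k) 2)
  have hlow : Tendsto (fun t => W * (Real.exp (-(lam k * ((u t + u (-t) - 2 * g x) / 2))) *
      (a k v - (u t - u (-t)) / 2 / t) ^ 2)) (𝓝[≠] 0) (𝓝 (W * (a k v - deriv u 0) ^ 2)) := by
    have h1 : Tendsto (fun t => Real.exp (-(lam k * ((u t + u (-t) - 2 * g x) / 2)))) (𝓝[≠] 0)
        (𝓝 1) := by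
      have := (Real.continuous_exp.tendsto _).comp (((hq0.div_const 2).const_mul (lam k)).neg)
      simpa [Function.comp_def] using this
    simpa using (h1.mul ((hd.const_sub (a k v)).pow 2)).const_mul W
  have hle := le_of_tendsto_of_tendsto hlow (hq.const_mul L) (by
    filter_upwards [self_mem_nhdsWithin] with t ht
    have ht' : t ≠ 0 := ht
    have h1 := h.sq_le_second_difference hf hfg hg x v k t
    have ht2 : 0 < t ^ 2 := by positivity
    calc _ = W * (Real.exp (-(lam k * ((u t + u (-t) - 2 * g x) / 2))) *
          (t * a k v - (u t - u (-t)) / 2) ^ 2) / t ^ 2 := by field_simp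
      _ ≤ L * (u t + u (-t) - 2 * g x) / t ^ 2 := by gcongr
      _ = _ := by ring)
  have hne : a k v - deriv u 0 ≠ 0 := sub_ne_zero.2 hk
  have hpos : 0 < W * (a k v - deriv u 0) ^ 2 := by positivity
  exact pos_of_mul_pos_right (hpos.trans_le hle) hLpos.le

end IsSharpAffineFamily
end

/-! ### Construction of the affine family -/

lemma exists_weights {ι : Type*} [Countable ι] {μ : ι → ℝ} (hμ : ∀ i, 0 < μ i) :
    ∃ lam : ι → ℝ, (∀ i, 0 < lam i) ∧
      (∀ c : ℝ, 0 < c → Summable fun i => Real.exp (-(c * lam i))) ∧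
      (Summable fun i => Real.exp (-(lam i * μ i))) ∧
      ∑' i, Real.exp (-(lam i * μ i)) ≤ 1 := by
  cases nonempty_encodable ι
  obtain ⟨η, hη, c, hc, hc1⟩ := posSumOfEncodable one_pos ι
  -- The encoding term gives geometric decay for every `c`; the logarithmic term gives `exp (-(lam i
  -- * μ i)) ≤ η i`, where the `η i` have sum at most 1.
  set lam : ι → ℝ := fun i => (Encodable.encode i + 1) + |Real.log (η i)| / μ i with hlam
  have hge : ∀ i, (Encodable.encode i : ℝ) + 1 ≤ lam i := fun i =>
    le_add_of_nonneg_right (div_nonneg (abs_nonneg _) (hμ i).le)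
  have hle : ∀ i, Real.exp (-(lam i * μ i)) ≤ η i := fun i => by
    rw [← Real.le_log_iff_exp_le (hη i)]
    have h1 : |Real.log (η i)| ≤ lam i * μ i := by
      have : |Real.log (η i)| = |Real.log (η i)| / μ i * μ i := by
        rw [div_mul_cancel₀ _ (hμ i).ne']
      rw [this]
      refine mul_le_mul_of_nonneg_right ?_ (hμ i).le
      exact le_add_of_nonneg_left (by positivity)
    linarith [neg_abs_le (Real.log (η i))]
  have hs : Summable fun i => Real.exp (-(lam i * μ i)) :=
    Summable.of_nonneg_of_le (fun i => (Real.exp_pos _).le) hle hc.summable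
  refine ⟨lam, fun i => lt_of_lt_of_le (by positivity) (hge i), fun c hc => ?_, hs, ?_⟩
  · have h1 : Summable fun i : ι => Real.exp ((Encodable.encode i : ℝ) * (-c)) :=
      (Real.summable_exp_nat_mul_iff.2 (neg_neg_of_pos hc)).comp_injective
        Encodable.encode_injective
    refine Summable.of_nonneg_of_le (fun i => (Real.exp_pos _).le) (fun i => ?_) h1
    rw [Real.exp_le_exp]
    nlinarith [hge i]
  · refine le_trans ?_ hc1
    rw [← hc.tsum_eq]
    exact hs.tsum_le_tsum hle hc.summable

section

variable {E : Type*} [NormedAddCommGroup E] [NormedSpace ℝ E] {f : E → ℝ}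

lemma exists_affine_minorant (hf : ConvexOn ℝ univ f) (hfc : Continuous f) (y : E) {s : ℝ}
    (hs : s < f y) : ∃ (l : E →L[ℝ] ℝ) (c : ℝ), (∀ x, l x + c ≤ f x) ∧ l y + c = s := by
  obtain ⟨l, c, hl, hly⟩ := hf.exists_affine_le_of_lt (𝕜 := ℝ) (mem_univ y) hs isClosed_univ
    (hfc.lowerSemicontinuous.lowerSemicontinuousOn _)
  exact ⟨l, c, fun x => hl ⟨x, mem_univ x⟩, hly⟩

/-- Finitely many affine functions that lie above a nonnegative coercive convex function `f`
somewhere on `{f ≤ n}`, but exceed it only slightly. -/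
lemma exists_finite_affine_family (hf : ConvexOn ℝ univ f) (hfc : Continuous f)
    (hf0 : ∀ x, 0 ≤ f x) (hK : ∀ β, IsCompact {x | f x ≤ β}) {ε : E → ℝ} (hε : Continuous ε)
    (hε0 : ∀ x, 0 < ε x) (n : ℕ) :
    ∃ (t : Finset E) (l : E → E →L[ℝ] ℝ) (c : E → ℝ) (μ : ℝ), 0 < μ ∧
      (∀ y ∈ t, ∀ x, l y x + c y ≤ f x + ε x - μ) ∧
      (∀ y ∈ t, ∀ x, l y x + c y ≤ f x + 1 / (n + 1)) ∧
      ∀ x, f x ≤ n → ∃ y ∈ t, f x < l y x + c y := by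
  -- Where `f > n + 2` the affine functions built below lie under `f - σ`, so only the minimum of
  -- `ε` on this compact set matters.
  obtain ⟨η, hη, hηε⟩ := (hK (n + 2)).exists_forall_le' hε.continuousOn fun x _ => hε0 x
  set m := min (η / 2) (1 / ((n : ℝ) + 1)) with hm
  have hn : (0 : ℝ) < n + 1 := by positivity
  have hm0 : 0 < m := lt_min (by linarith) (by positivity)
  set σ := min (1 / 2) (m / (n + 1)) with hσ
  have hσ0 : 0 < σ := lt_min (by norm_num) (by positivity)
  have hσ1 : σ ≤ 1 / 2 := min_le_left _ _
  have hσm : σ * (n + 1) ≤ m := (le_div_iff₀ hn).1 (min_le_right _ _)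
  have hmη : m ≤ η / 2 := min_le_left _ _
  have hmn : m ≤ 1 / ((n : ℝ) + 1) := min_le_right _ _
  choose T c hT hTy using fun y => exists_affine_minorant hf hfc y
    (show f y - σ / 2 < f y by linarith)
  -- A near-supporting minorant is mixed with the constant `n + 1`. The excess over `f` is at most
  -- `σ * (n + 1 - f x)`; at `y` with `f y ≤ n` the mixture gains at least `σ`, more than the loss
  -- `σ / 2` in the minorant.
  set l : E → E →L[ℝ] ℝ := fun y => (1 - σ) • T y with hl
  set c' : E → ℝ := fun y => (1 - σ) * c y + σ * (n + 1) with hc'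
  have hle : ∀ y x, l y x + c' y ≤ f x + σ * (n + 1 - f x) := fun y x => by
    have h1 := mul_le_mul_of_nonneg_left (hT y x) (show 0 ≤ 1 - σ by linarith)
    simp only [hl, hc', smul_apply, smul_eq_mul]
    linarith
  obtain ⟨t, htK, ht⟩ := (hK n).elim_nhds_subcover (fun y => {x | f x < l y x + c' y})
    fun y hy => by
      refine (isOpen_lt hfc (by fun_prop)).mem_nhds ?_
      have h1 : σ * f y ≤ σ * n := mul_le_mul_of_nonneg_left hy hσ0.le
      have h2 := hTy y
      have h3 : T y y = f y - σ / 2 - c y := by linarith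
      simp only [mem_ofPred_eq, hl, hc', smul_apply, smul_eq_mul, h3]
      nlinarith
  refine ⟨t, l, c', min (η / 2) σ, lt_min (by linarith) hσ0, fun y _ x => ?_, fun y _ x => ?_,
    fun x hx => ?_⟩
  · have h1 := hle y x
    have h2 : min (η / 2) σ ≤ η / 2 := min_le_left _ _
    have h3 : min (η / 2) σ ≤ σ := min_le_right _ _
    have h4 := mul_nonneg hσ0.le (hf0 x)
    have h5 := hε0 x
    rcases le_or_gt (f x) (n + 2) with h | h
    · have := hηε x h
      linarith
    · have := mul_lt_mul_of_pos_left h hσ0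
      linarith
  · have h1 := hle y x
    have h4 := mul_nonneg hσ0.le (hf0 x)
    linarith
  · simpa using ht hx

/-- The affine functions from which analytic approximations of `f` are built. -/
lemma exists_isSharpAffineFamily.{u} {E : Type u} [NormedAddCommGroup E] [NormedSpace ℝ E]
    {f : E → ℝ} (hf : ConvexOn ℝ univ f) (hfc : Continuous f)
    (hf0 : ∀ x, 0 ≤ f x) (hK : ∀ β, IsCompact {x | f x ≤ β}) {ε : E → ℝ} (hε : Continuous ε)
    (hε0 : ∀ x, 0 < ε x) :
    ∃ (ι : Type u) (a : ι → E →L[ℝ] ℝ) (b lam : ι → ℝ), IsSharpAffineFamily f a b lam ∧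
      (∀ x, expSum a b lam (x, f x + ε x) ≤ 1) ∧ (∀ i x, a i x + b i ≤ f x + ε x) ∧
      ∀ i x, a i x + b i ≤ f x + 1 := by
  choose t l c μ hμ hlε hln hlt using exists_finite_affine_family hf hfc hf0 hK hε hε0
  obtain ⟨lam, hlam, hsum, hs, hlam1⟩ := exists_weights (ι := Σ n, {y // y ∈ t n})
    (μ := fun i => μ i.1) fun i => hμ i.1
  have hμi : ∀ (i : Σ n, {y // y ∈ t n}) x, l i.1 i.2 x + c i.1 i.2 ≤ f x + ε x - μ i.1 :=
    fun i x => hlε i.1 i.2 i.2.2 x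
  refine ⟨Σ n, {y // y ∈ t n}, fun i => l i.1 i.2, fun i => c i.1 i.2, lam,
    ⟨hlam, hsum, fun δ hδ => ?_, fun x => ?_⟩, fun x => ?_, fun i x => ?_, fun i x => ?_⟩
  · obtain ⟨N, hN⟩ := exists_nat_one_div_lt hδ
    have hfin : (⋃ n ∈ Iic N, range fun y : {y // y ∈ t n} =>
        (⟨n, y⟩ : Σ n, {y // y ∈ t n})).Finite :=
      (finite_Iic N).biUnion fun n _ => finite_range _
    filter_upwards [hfin.compl_mem_cofinite] with i hi x
    have hNi : N ≤ i.1 := by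
      by_contra! hlt
      exact hi (mem_biUnion (show i.1 ∈ Iic N from hlt.le) ⟨i.2, rfl⟩)
    refine (hln i.1 i.2 i.2.2 x).trans ?_
    have : 1 / ((i.1 : ℝ) + 1) ≤ 1 / ((N : ℝ) + 1) := Nat.one_div_le_one_div hNi
    linarith
  · obtain ⟨n, hn⟩ := exists_nat_ge (f x)
    obtain ⟨y, hy, hlt⟩ := hlt n x hn
    exact ⟨⟨n, y, hy⟩, hlt⟩
  · have hle : ∀ i : Σ n, {y // y ∈ t n},
        Real.exp (lam i * (l i.1 i.2 x + c i.1 i.2 - (f x + ε x))) ≤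
          Real.exp (-(lam i * μ i.1)) := fun i => by
      rw [Real.exp_le_exp, ← mul_neg]
      exact mul_le_mul_of_nonneg_left (by linarith [hμi i x]) (hlam i).le
    exact ((Summable.of_nonneg_of_le (fun i => (Real.exp_pos _).le) hle hs).tsum_le_tsum
      hle hs).trans hlam1
  · linarith [hμi i x, hμ i.1]
  · refine (hln i.1 i.2 i.2.2 x).trans ?_
    have : 1 / ((i.1 : ℝ) + 1) ≤ 1 := by
      rw [div_le_one (by positivity)]
      linarith [(Nat.cast_nonneg i.1 : (0 : ℝ) ≤ i.1)]
    linarith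

end

/-! ### Fine analytic approximation in the coercive case -/

/-- A nonnegative coercive convex function is finely approximated by analytic functions with
positive definite Hessian. -/
theorem exists_analytic_approx {E : Type*} [NormedAddCommGroup E] [NormedSpace ℝ E]
    [FiniteDimensional ℝ E] {f : E → ℝ} (hf : ConvexOn ℝ univ f)
    (hf0 : ∀ x, 0 ≤ f x) (hlim : Tendsto f (Bornology.cobounded E) atTop) {ε : E → ℝ}
    (hε : Continuous ε) (hε0 : ∀ x, 0 < ε x) :
    ∃ g : E → ℝ, AnalyticOnNhd ℝ g univ ∧ (∀ x, |f x - g x| ≤ ε x) ∧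
      ∀ x v : E, v ≠ 0 → 0 < iteratedDeriv 2 (fun t : ℝ => g (x + t • v)) 0 := by
  have hfc : Continuous f := continuousOn_univ.1 (hf.continuousOn isOpen_univ)
  have : ProperSpace E := FiniteDimensional.proper ℝ E
  have : CompleteSpace E := FiniteDimensional.complete ℝ E
  have hK : ∀ β, IsCompact {x | f x ≤ β} := fun β => by
    refine Metric.isCompact_of_isClosed_isBounded (isClosed_le hfc continuous_const) ?_
    have := hlim.eventually_gt_atTop β
    rw [← Bornology.isCobounded_compl_iff]
    filter_upwards [this] with x hx
    simpa using hx
  obtain ⟨ι, a, b, lam, h, h1, hle, hle1⟩ := exists_isSharpAffineFamily hf hfc hf0 hK hε hε0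
  obtain ⟨g, hg⟩ := h.exists_expSum_eq_one hfc h1 hle
  have hfg : ∀ x, f x < g x := fun x => (hg x).1
  have hg1 : ∀ x, expSum a b lam (x, g x) = 1 := fun x => (hg x).2.2
  have hgc : Continuous g := continuousOn_univ.1
    ((h.convexOn_of_expSum_eq_one hfc hf hfg hg1).continuousOn isOpen_univ)
  have hga : AnalyticOnNhd ℝ g univ := fun x _ => h.analyticAt_of_expSum_eq_one hfc hgc hfg hg1 x
  refine ⟨g, hga, fun x => ?_, fun x v hv => ?_⟩
  · rw [abs_sub_comm, abs_of_pos (sub_pos.2 (hfg x))]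
    linarith [(hg x).2.1]
  · refine h.iteratedDeriv_two_pos hfc hga.contDiff hfg hg1 (fun α => ?_) x
    by_contra! hα
    -- If all `a i` took one value `α ≤ 0` at `w`, every `a i + b i` would stay below `f 0 + 1`
    -- along the ray through `w`, yet some member exceeds `f` at each of its points.
    have hbd : ∀ w : E, w ≠ 0 → ∀ α : ℝ, α ≤ 0 → (∀ i, a i w = α) → False := by
      intro w hw α hα0 hα
      have hray : Tendsto (fun n : ℕ => (n : ℝ) • w) atTop (Bornology.cobounded E) := by
        rw [← tendsto_norm_atTop_iff_cobounded]
        simp only [norm_smul, Real.norm_natCast]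
        exact tendsto_natCast_atTop_atTop.atTop_mul_const (norm_pos_iff.2 hw)
      obtain ⟨n, hn⟩ := ((hlim.comp hray).eventually_gt_atTop (f 0 + 1)).exists
      obtain ⟨i, hi⟩ := h.exists_lt ((n : ℝ) • w)
      have h2 := hle1 i 0
      simp only [map_smul, hα, map_zero, smul_eq_mul, Function.comp_apply] at h2 hi hn
      have : (n : ℝ) * α ≤ 0 := mul_nonpos_of_nonneg_of_nonpos (Nat.cast_nonneg n) hα0
      linarith
    rcases le_total α 0 with h0 | h0
    · exact hbd v hv α h0 hα
    · exact hbd (-v) (neg_ne_zero.2 hv) (-α) (by linarith) fun i => by rw [map_neg, hα]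

/-! ### Convexity along lines and strong convexity -/

/-- A convex function that is bounded above is constant. -/
lemma ConvexOn.eq_of_forall_le {V : Type*} [AddCommGroup V] [Module ℝ V] {h : V → ℝ}
    (hh : ConvexOn ℝ univ h) {M : ℝ} (hM : ∀ x, h x ≤ M) (x y : V) : h x = h y := by
  have key : ∀ x y, h y ≤ h x := fun x y => by
    by_contra! hlt
    -- Extrapolating the increase from `x` to `y` by the factor `n` overshoots `M`.
    obtain ⟨n, hn⟩ := exists_nat_gt ((M - h x) / (h y - h x))
    have hd : 0 < h y - h x := sub_pos.2 hlt
    rw [div_lt_iff₀ hd] at hn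
    have hn0 : (0 : ℝ) < n := by
      have : 0 ≤ M - h x := sub_nonneg.2 (hM x)
      by_contra! hneg
      nlinarith
    have hn1 : (1 : ℝ) ≤ n := by exact_mod_cast Nat.cast_pos.1 hn0
    have hinv : (0 : ℝ) ≤ 1 - (n : ℝ)⁻¹ := sub_nonneg.2 (inv_le_one_of_one_le₀ hn1)
    have h1 := hh.2 (mem_univ x) (mem_univ (x + (n : ℝ) • (y - x))) hinv
      (inv_nonneg.2 hn0.le) (by ring)
    have h2 : (1 - (n : ℝ)⁻¹) • x + (n : ℝ)⁻¹ • (x + (n : ℝ) • (y - x)) = y := by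
      rw [smul_add, smul_smul, inv_mul_cancel₀ hn0.ne']
      module
    rw [h2, smul_eq_mul, smul_eq_mul] at h1
    have h3 := mul_le_mul_of_nonneg_left (hM (x + (n : ℝ) • (y - x))) (inv_nonneg.2 hn0.le)
    have h4 : h y - h x ≤ (n : ℝ)⁻¹ * (M - h x) := by linarith
    have h5 := mul_le_mul_of_nonneg_left h4 hn0.le
    rw [← mul_assoc, mul_inv_cancel₀ hn0.ne', one_mul] at h5
    linarith
  exact le_antisymm (key y x) (key x y)

lemma ConvexOn.comp_line {V : Type*} [AddCommGroup V] [Module ℝ V] {h : V → ℝ}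
    (hh : ConvexOn ℝ univ h) (x v : V) : ConvexOn ℝ univ fun t : ℝ => h (x + t • v) := by
  refine ⟨convex_univ, fun s _ t _ α β hα hβ hαβ => ?_⟩
  convert! hh.2 (mem_univ (x + s • v)) (mem_univ (x + t • v)) hα hβ hαβ using 2
  have : x = (α + β) • x := by rw [hαβ, one_smul]
  nth_rewrite 1 [this]
  simp only [smul_eq_mul]
  module

lemma convexOn_of_comp_line {V : Type*} [AddCommGroup V] [Module ℝ V] {h : V → ℝ}
    (hh : ∀ x v : V, v ≠ 0 → ConvexOn ℝ univ fun t : ℝ => h (x + t • v)) :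
    ConvexOn ℝ univ h := by
  refine ⟨convex_univ, fun x _ y _ α β hα hβ hαβ => ?_⟩
  rcases eq_or_ne y x with rfl | hne
  · rw [← add_smul, ← add_smul, hαβ, one_smul, one_smul]
  · have h1 := (hh x (y - x) (sub_ne_zero.2 hne)).2 (mem_univ 0) (mem_univ 1) hα hβ hαβ
    obtain rfl : α = 1 - β := by linarith
    have h2 : x + ((1 - β) • (0 : ℝ) + β • 1) • (y - x) = (1 - β) • x + β • y := by
      simp only [smul_eq_mul]
      module
    simp only [h2, zero_smul, add_zero, one_smul, add_sub_cancel] at h1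
    exact h1

section

variable {d : ℕ} {f : EuclideanSpace ℝ (Fin d) → ℝ}

/-- Midpoint convexity of `f - φ` makes the symmetric second differences of `f` dominate those of
`φ`, and this passes to the limit. -/
lemma IsStronglyConvex.iteratedDeriv_two_nonneg (hf : IsStronglyConvex f) (hf2 : ContDiff ℝ 2 f)
    (x : EuclideanSpace ℝ (Fin d)) {v : EuclideanSpace ℝ (Fin d)} (hv : v ≠ 0) :
    0 ≤ iteratedDeriv 2 (fun t : ℝ => f (x + t • v)) 0 := by
  obtain ⟨V, hV, hxV, φ, ⟨hφ, hφpos⟩, hconv⟩ := hf x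
  have hline : Continuous fun t : ℝ => x + t • v := by fun_prop
  have hmem : (fun t : ℝ => x + t • v) ⁻¹' V ∈ 𝓝 (0 : ℝ) :=
    (hV.preimage hline).mem_nhds (by simpa using hxV)
  obtain ⟨δ, hδ, hball⟩ := Metric.mem_nhds_iff.1 hmem
  rw [Real.ball_eq_Ioo, zero_sub, zero_add] at hball
  have h1 := tendsto_second_difference hδ
    (u := fun t : ℝ => f (x + t • v)) (hf2.comp (by fun_prop)).contDiffOn
  have h2 := tendsto_second_difference hδ (u := fun t : ℝ => φ (x + t • v))
    (hφ.comp (f := fun t : ℝ => x + t • v) (by fun_prop) hball)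
  refine (hφpos x hxV v hv).le.trans (le_of_tendsto_of_tendsto h2 h1 ?_)
  filter_upwards [nhdsWithin_le_nhds (Ioo_mem_nhds (neg_neg_of_pos hδ) hδ)] with t ht
  refine div_le_div_of_nonneg_right ?_ (sq_nonneg t)
  have h3 := hconv.2 (hball ht) (hball (show -t ∈ Ioo (-δ) δ from
    ⟨by linarith [ht.2], by linarith [ht.1]⟩)) (show (0 : ℝ) ≤ 1 / 2 by norm_num)
    (show (0 : ℝ) ≤ 1 / 2 by norm_num) (by norm_num)
  have h4 : (1 / 2 : ℝ) • (x + t • v) + (1 / 2 : ℝ) • (x + (-t) • v) = x := by module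
  simp only [h4, smul_eq_mul] at h3
  simp only [zero_smul, add_zero]
  linarith

lemma IsStronglyConvex.convexOn (hf : IsStronglyConvex f) (hf2 : ContDiff ℝ 2 f) :
    ConvexOn ℝ univ f := by
  refine convexOn_of_comp_line fun x v hv => ?_
  have hu : ContDiff ℝ 2 fun t : ℝ => f (x + t • v) := hf2.comp (by fun_prop)
  refine convexOn_univ_of_deriv2_nonneg (hu.differentiable (by norm_num)) ?_ fun t => ?_
  · have := hu.differentiable_iteratedDeriv 1 (by norm_num)
    rwa [iteratedDeriv_one] at this
  · rw [← iteratedDeriv_eq_iterate]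
    have h1 := hf.iteratedDeriv_two_nonneg hf2 (x + t • v) hv
    have h2 := congrFun (iteratedDeriv_comp_const_add 2 (fun t : ℝ => f (x + t • v)) t) 0
    rw [add_zero] at h2
    rw [← h2]
    convert! h1 using 3
    congr 1
    module

/-! ### Proper convexity, coercivity and affine directions -/

lemma IsProperlyConvex.exists_coercive [NeZero d] (hf : IsProperlyConvex f) :
    ∃ (ℓ : EuclideanSpace ℝ (Fin d) →ₗ[ℝ] ℝ) (c : EuclideanSpace ℝ (Fin d) → ℝ),
      (∀ x, f x = ℓ x + c x) ∧
        Tendsto c (Bornology.cobounded (EuclideanSpace ℝ (Fin d))) atTop := by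
  obtain ⟨ℓ, c, a, b, hfc, hab, hc, hconv, hcomp⟩ := hf
  refine ⟨ℓ, c, hfc, ?_⟩
  rcases eq_or_ne b ⊤ with rfl | hb
  · refine tendsto_atTop.2 fun β => ?_
    have h1 := (hcomp (max a β) (le_max_left _ _) (EReal.coe_lt_top _)).isBounded
    rw [← Bornology.isCobounded_compl_iff] at h1
    filter_upwards [h1] with x hx
    by_contra! hlt
    exact hx ⟨(hc x).1, hlt.le.trans (le_max_right _ _)⟩
  -- A finite `b` would make `c` bounded, hence constant, and one of its compact sublevel sets would
  -- be the whole space, which is noncompact as `d ≠ 0`.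
  · exfalso
    have hbd : ∀ x, c x ≤ b.toReal := fun x => by
      have h1 := (hc x).2.le
      rwa [← EReal.coe_toReal hb (ne_bot_of_gt hab), EReal.coe_le_coe_iff] at h1
    have h1 : c ⁻¹' Icc a (c 0) = univ :=
      eq_univ_of_forall fun x => ⟨(hc x).1, (hconv.eq_of_forall_le hbd x 0).le⟩
    have h2 := hcomp (c 0) (hc 0).1 (hc 0).2
    rw [h1] at h2
    exact noncompact_univ _ h2

lemma ConvexOn.sub_linear (hf : ConvexOn ℝ univ f) {ℓ : EuclideanSpace ℝ (Fin d) →ₗ[ℝ] ℝ}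
    {c : EuclideanSpace ℝ (Fin d) → ℝ} (hfc : ∀ x, f x = ℓ x + c x) : ConvexOn ℝ univ c := by
  have h1 : c = fun x => f x + (-ℓ) x := by
    funext x
    rw [hfc, LinearMap.neg_apply]
    ring
  rw [h1]
  exact hf.add ((-ℓ).convexOn convex_univ)

lemma isProperlyConvex_of_coercive (hf : ConvexOn ℝ univ f)
    {ℓ : EuclideanSpace ℝ (Fin d) →ₗ[ℝ] ℝ} {c : EuclideanSpace ℝ (Fin d) → ℝ}
    (hfc : ∀ x, f x = ℓ x + c x)
    (hc : Tendsto c (Bornology.cobounded (EuclideanSpace ℝ (Fin d))) atTop) :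
    IsProperlyConvex f := by
  have hconv := hf.sub_linear hfc
  have hcont : Continuous c := continuousOn_univ.1 (hconv.continuousOn isOpen_univ)
  obtain ⟨x₀, hx₀⟩ := hcont.exists_forall_le (by rwa [← Metric.cobounded_eq_cocompact])
  refine ⟨ℓ, c, c x₀, ⊤, hfc, EReal.coe_lt_top _, fun x => ⟨hx₀ x, EReal.coe_lt_top _⟩, hconv,
    fun β _ _ => ?_⟩
  refine Metric.isCompact_of_isClosed_isBounded (isClosed_Icc.preimage hcont) ?_
  rw [← Bornology.isCobounded_compl_iff]
  filter_upwards [hc.eventually_gt_atTop β] with x hx hmem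
  exact absurd hmem.2 (not_le.2 hx)

/-- The affine minorants of `f` either have slopes filling an open set, or `f` is affine in some
direction. -/
lemma exists_coercive_or_affine_direction (hf : ConvexOn ℝ univ f) :
    (∃ (ℓ : EuclideanSpace ℝ (Fin d) →ₗ[ℝ] ℝ) (c : EuclideanSpace ℝ (Fin d) → ℝ),
      (∀ x, f x = ℓ x + c x) ∧
        Tendsto c (Bornology.cobounded (EuclideanSpace ℝ (Fin d))) atTop) ∨
    ∃ (v : EuclideanSpace ℝ (Fin d)) (α : ℝ), v ≠ 0 ∧ ∀ x, ∀ t : ℝ, f (x + t • v) = f x + t * α := by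
  have hfc : Continuous f := continuousOn_univ.1 (hf.continuousOn isOpen_univ)
  set S : Set (EuclideanSpace ℝ (Fin d)) := {ξ | ∃ C : ℝ, ∀ x, inner ℝ ξ x + C ≤ f x} with hS
  have hSconv : Convex ℝ S := by
    rintro ξ ⟨C, hC⟩ ζ ⟨D, hD⟩ α β hα hβ hαβ
    refine ⟨α * C + β * D, fun x => ?_⟩
    rw [inner_add_left, real_inner_smul_left, real_inner_smul_left]
    have h1 := mul_le_mul_of_nonneg_left (hC x) hα
    have h2 := mul_le_mul_of_nonneg_left (hD x) hβ
    have h3 : f x = α * f x + β * f x := by rw [← add_mul, hαβ, one_mul]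
    linarith
  have hmin : ∀ y, ∀ δ > 0, ∃ ξ ∈ S, ∃ C : ℝ, (∀ x, inner ℝ ξ x + C ≤ f x) ∧
      inner ℝ ξ y + C = f y - δ := fun y δ hδ => by
    obtain ⟨l, c, hl, hly⟩ := exists_affine_minorant hf hfc y (show f y - δ < f y by linarith)
    have hrep : ∀ x, inner ℝ ((InnerProductSpace.toDual ℝ _).symm l) x = l x := fun x =>
      InnerProductSpace.toDual_symm_apply
    refine ⟨(InnerProductSpace.toDual ℝ _).symm l, ⟨c, fun x => ?_⟩, c, fun x => ?_, ?_⟩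
    · rw [hrep]; exact hl x
    · rw [hrep]; exact hl x
    · rw [hrep]; exact hly
  by_cases htop : affineSpan ℝ S = ⊤
  -- Minorants with slopes `ξ ± ρ • e i` give `f - ⟨ξ, ·⟩ ≥ ρ * |x i| - K` for each `i`; summing
  -- over `i` yields linear growth.
  · left
    obtain ⟨ξ, hξ⟩ := hSconv.interior_nonempty_iff_affineSpan_eq_top.2 htop
    obtain ⟨r, hr, hball⟩ := Metric.mem_nhds_iff.1 (mem_interior_iff_mem_nhds.1 hξ)
    set ρ := r / 2 with hρ
    have hρ0 : 0 < ρ := by linarith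
    set e : Fin d → EuclideanSpace ℝ (Fin d) := fun i => EuclideanSpace.single i 1 with he
    have hmemS : ∀ i, ∀ s : ℝ, |s| = ρ → ξ + s • e i ∈ S := fun i s hs => hball (by
      rw [mem_ball_iff_norm, add_sub_cancel_left, norm_smul, Real.norm_eq_abs, hs,
        show ‖e i‖ = 1 by simp [he]]
      linarith)
    choose C₁ hC₁ using fun i => hmemS i ρ (abs_of_pos hρ0)
    choose C₂ hC₂ using fun i => hmemS i (-ρ) (by rw [abs_neg, abs_of_pos hρ0])
    set K := ∑ i, (|C₁ i| + |C₂ i|) with hK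
    have hcoord : ∀ i x, ρ * |x i| - K ≤ f x - inner ℝ ξ x := fun i x => by
      have hKi : |C₁ i| + |C₂ i| ≤ K :=
        Finset.single_le_sum (f := fun i => |C₁ i| + |C₂ i|) (fun i _ => by positivity)
          (Finset.mem_univ i)
      have h1 := hC₁ i x
      have h2 := hC₂ i x
      rw [inner_add_left, real_inner_smul_left] at h1 h2
      have h3 : inner ℝ (e i) x = x i := by simp [he, EuclideanSpace.inner_single_left]
      rw [h3] at h1 h2
      have h4 := neg_abs_le (C₁ i)
      have h5 := neg_abs_le (C₂ i)
      have h6 := abs_nonneg (C₁ i)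
      have h7 := abs_nonneg (C₂ i)
      rcases abs_cases (x i) with ⟨h, _⟩ | ⟨h, _⟩ <;> rw [h] <;> linarith
    refine ⟨(innerSL ℝ ξ).toLinearMap, fun x => f x - inner ℝ ξ x, fun x => by simp, ?_⟩
    have hnorm : ∀ x : EuclideanSpace ℝ (Fin d), ‖x‖ ≤ ∑ i, |x i| := fun x => by
      rw [EuclideanSpace.norm_eq]
      refine Real.sqrt_le_iff.2 ⟨Finset.sum_nonneg fun i _ => abs_nonneg _, ?_⟩
      exact Finset.sum_sq_le_sq_sum_of_nonneg fun i _ => abs_nonneg _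
    have hd : ∀ x, ρ * ‖x‖ - d * K ≤ d * (f x - inner ℝ ξ x) := fun x => by
      have h1 : ∑ i, (ρ * |x i| - K) ≤ ∑ _i : Fin d, (f x - inner ℝ ξ x) :=
        Finset.sum_le_sum fun i _ => hcoord i x
      rw [Finset.sum_sub_distrib, ← Finset.mul_sum] at h1
      simp only [Finset.sum_const, Finset.card_univ, Fintype.card_fin, nsmul_eq_mul] at h1
      have h2 := mul_le_mul_of_nonneg_left (hnorm x) hρ0.le
      linarith
    rcases Nat.eq_zero_or_pos d with hd0 | hd0
    · subst hd0
      have : Bornology.cobounded (EuclideanSpace ℝ (Fin 0)) = ⊥ := by simp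
      rw [this]
      exact tendsto_bot
    · have hdpos : (0 : ℝ) < d := Nat.cast_pos.2 hd0
      have h1 : Tendsto (fun x : EuclideanSpace ℝ (Fin d) => (ρ * ‖x‖ + -(d * K)) / d)
          (Bornology.cobounded _) atTop :=
        (tendsto_atTop_add_const_right _ _
          (tendsto_norm_cobounded_atTop.const_mul_atTop hρ0)).atTop_div_const hdpos
      refine tendsto_atTop_mono (fun x => ?_) h1
      rw [div_le_iff₀ hdpos]
      linarith [hd x]
  · right
    obtain ⟨ξ₁, hξ₁, -⟩ := hmin 0 1 one_pos
    have hdir : (affineSpan ℝ S).direction ≠ ⊤ := fun h =>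
      htop ((AffineSubspace.direction_eq_top_iff_of_nonempty ⟨ξ₁, subset_affineSpan ℝ S hξ₁⟩).1 h)
    have hperp : ((affineSpan ℝ S).direction)ᗮ ≠ ⊥ := fun h =>
      hdir ((Submodule.orthogonal_eq_bot_iff).1 h)
    obtain ⟨v, hv, hv0⟩ := Submodule.exists_mem_ne_zero_of_ne_bot hperp
    have hconst : ∀ ξ ∈ S, inner ℝ ξ v = inner ℝ ξ₁ v := fun ξ hξ => by
      have h1 := (Submodule.mem_orthogonal _ v).1 hv (ξ -ᵥ ξ₁)
        (AffineSubspace.vsub_mem_direction (subset_affineSpan ℝ S hξ) (subset_affineSpan ℝ S hξ₁))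
      rw [vsub_eq_sub, inner_sub_left] at h1
      linarith
    refine ⟨v, inner ℝ ξ₁ v, hv0, ?_⟩
    -- All minorants have the same slope along `v`, so one nearly touching at `x` bounds `f` below
    -- on the line. Starting instead from `x + t • v` with `-t` gives the reverse inequality.
    have hge : ∀ x, ∀ t : ℝ, f x + t * inner ℝ ξ₁ v ≤ f (x + t • v) := fun x t => by
      refine le_of_forall_pos_le_add fun δ hδ => ?_
      obtain ⟨ξ, hξ, C, hC, hx⟩ := hmin x δ hδ
      have h1 := hC (x + t • v)
      rw [inner_add_right, real_inner_smul_right, hconst ξ hξ] at h1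
      linarith
    intro x t
    refine le_antisymm ?_ (hge x t)
    have h1 := hge (x + t • v) (-t)
    rw [show x + t • v + (-t) • v = x by module] at h1
    linarith

/-- A convex function that is affine in some direction factors through a quotient of smaller
dimension, up to a linear function. -/
lemma exists_factorization_of_affine_direction (hf : ConvexOn ℝ univ f)
    {v : EuclideanSpace ℝ (Fin d)} {α : ℝ} (hv : v ≠ 0)
    (hα : ∀ x, ∀ t : ℝ, f (x + t • v) = f x + t * α) :
    ∃ k : ℕ, k < d ∧
      ∃ (P : EuclideanSpace ℝ (Fin d) →ₗ[ℝ] EuclideanSpace ℝ (Fin k))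
        (c : EuclideanSpace ℝ (Fin k) → ℝ) (ℓ : EuclideanSpace ℝ (Fin d) →ₗ[ℝ] ℝ),
        Function.Surjective P ∧ ConvexOn ℝ univ c ∧ ∀ x, f x = c (P x) + ℓ x := by
  set N := Submodule.span ℝ {v} with hN
  set k := Module.finrank ℝ (EuclideanSpace ℝ (Fin d) ⧸ N) with hk
  have hkd : k + 1 = d := by
    have h1 := N.finrank_quotient_add_finrank
    rwa [finrank_span_singleton hv, finrank_euclideanSpace_fin] at h1
  let e : (EuclideanSpace ℝ (Fin d) ⧸ N) ≃ₗ[ℝ] EuclideanSpace ℝ (Fin k) :=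
    LinearEquiv.ofFinrankEq _ _ (by rw [finrank_euclideanSpace_fin])
  let P : EuclideanSpace ℝ (Fin d) →ₗ[ℝ] EuclideanSpace ℝ (Fin k) := e.toLinearMap ∘ₗ N.mkQ
  have hP : Function.Surjective P := e.surjective.comp N.mkQ_surjective
  obtain ⟨J, hJ⟩ := P.exists_rightInverse_of_surjective (LinearMap.range_eq_top.2 hP)
  have hJ' : ∀ z, P (J z) = z := fun z => LinearMap.congr_fun hJ z
  have hker : ∀ x, ∃ t : ℝ, t • v = x - J (P x) := fun x => by
    rw [← Submodule.mem_span_singleton, ← hN, ← Submodule.Quotient.mk_eq_zero, ← N.mkQ_apply,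
      ← e.map_eq_zero_iff]
    change P _ = 0
    rw [map_sub, hJ', sub_self]
  have hvv : inner ℝ v v ≠ (0 : ℝ) := inner_self_ne_zero.2 hv
  refine ⟨k, by omega, P, fun z => f (J z),
    -- This form sends `x` to `t * α` when `x - J (P x) = t • v`, restoring the affine part lost by
    -- passing to `J (P x)`.
    (α / inner ℝ v v) • ((innerSL ℝ v).toLinearMap ∘ₗ (LinearMap.id - J ∘ₗ P)), hP,
    by simpa [Function.comp_def] using hf.comp_linearMap J, fun x => ?_⟩
  obtain ⟨t, ht⟩ := hker x
  have h1 : ((α / inner ℝ v v) • ((innerSL ℝ v).toLinearMap ∘ₗ (LinearMap.id - J ∘ₗ P))) x =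
      t * α := by
    change α / inner ℝ v v * inner ℝ v (x - J (P x)) = t * α
    rw [← ht, real_inner_smul_right]
    field_simp
  rw [h1, ← hα, ht, add_sub_cancel]

lemma isFinelyApproximableBy_analytic_of_coercive (hf : ConvexOn ℝ univ f)
    {ℓ : EuclideanSpace ℝ (Fin d) →ₗ[ℝ] ℝ} {c : EuclideanSpace ℝ (Fin d) → ℝ}
    (hfc : ∀ x, f x = ℓ x + c x)
    (hc : Tendsto c (Bornology.cobounded (EuclideanSpace ℝ (Fin d))) atTop) :
    IsFinelyApproximableBy f {g | IsStronglyConvex g ∧ AnalyticOnNhd ℝ g univ} := by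
  intro ε hε hε0
  have hconv := hf.sub_linear hfc
  have hcont : Continuous c := continuousOn_univ.1 (hconv.continuousOn isOpen_univ)
  obtain ⟨x₀, hx₀⟩ := hcont.exists_forall_le (by rwa [← Metric.cobounded_eq_cocompact])
  obtain ⟨g, hga, hg, hg2⟩ := exists_analytic_approx (f := fun x => c x + -c x₀)
    (hconv.add_const _) (fun x => by linarith [hx₀ x]) (tendsto_atTop_add_const_right _ _ hc) hε hε0
  set L := ℓ.toContinuousLinearMap with hL
  have hLa : ∀ x, L x = ℓ x := fun x => rfl
  have hGa : AnalyticOnNhd ℝ (fun x => g x + (L x + c x₀)) univ :=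
    hga.add ((L.analyticOnNhd univ).add analyticOnNhd_const)
  -- The approximant serves as its own `φ` on `univ`, so the convex difference is zero.
  refine ⟨fun x => g x + (L x + c x₀), ⟨fun p => ⟨univ, isOpen_univ, mem_univ p, _,
    ⟨hGa.contDiff.contDiffOn, fun x _ v hv => ?_⟩, ?_⟩, hGa⟩, fun x => ?_⟩
  · have h1 : ContDiff ℝ 2 fun t : ℝ => g (x + t • v) := hga.contDiff.comp (by fun_prop)
    have h2 : ContDiff ℝ 2 fun t : ℝ => L (x + t • v) + c x₀ := by fun_prop
    have h3 : iteratedDeriv 2 (fun t : ℝ => L (x + t • v) + c x₀) 0 = 0 := by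
      simp [iteratedDeriv_succ, iteratedDeriv_zero]
    have h4 := iteratedDeriv_fun_add (n := 2) (x := (0 : ℝ)) h1.contDiffAt h2.contDiffAt
    rw [h4, h3, add_zero]
    exact hg2 x v hv
  · simpa using convexOn_const (0 : ℝ) (convex_univ (𝕜 := ℝ) (E := EuclideanSpace ℝ (Fin d)))
  · have := hg x
    rw [hfc]
    convert! this using 2
    simp only [hLa]
    ring

/-! ### Rigidity of degenerate functions and the equivalence -/

/-- If `f` is, up to a linear function, a function of fewer variables, then it coincides with every
convex function that approximates it sufficiently well. -/
lemma eq_of_factorization_of_abs_sub_le {k : ℕ} (hk : k < d)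
    {P : EuclideanSpace ℝ (Fin d) →ₗ[ℝ] EuclideanSpace ℝ (Fin k)}
    {c : EuclideanSpace ℝ (Fin k) → ℝ} {ℓ : EuclideanSpace ℝ (Fin d) →ₗ[ℝ] ℝ}
    (hfc : ∀ x, f x = c (P x) + ℓ x) {g : EuclideanSpace ℝ (Fin d) → ℝ} (hg : ConvexOn ℝ univ g)
    (hfg : ∀ x, |f x - g x| ≤ (1 + ‖x‖)⁻¹) : f = g := by
  obtain ⟨v, hv, hv0⟩ := Submodule.exists_mem_ne_zero_of_ne_bot
    (LinearMap.ker_ne_bot_of_finrank_lt (f := P) (by simpa using hk))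
  rw [LinearMap.mem_ker] at hv
  funext x
  have hline : ∀ t : ℝ, f (x + t • v) = f x + t * ℓ v := fun t => by
    rw [hfc, hfc x]
    simp only [map_add, map_smul, hv, smul_zero, add_zero, smul_eq_mul]
    ring
  have hconv : ConvexOn ℝ univ fun t : ℝ => g (x + t • v) - f (x + t • v) := by
    have h1 : ConvexOn ℝ univ fun t : ℝ => t * (-ℓ v) + -f x :=
      ((LinearMap.mulRight ℝ (-ℓ v)).convexOn convex_univ).add_const _
    convert! (hg.comp_line x v).add h1 using 2 with t
    simp only [Pi.add_apply, hline]
    ring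
  have hle : ∀ t : ℝ, |g (x + t • v) - f (x + t • v)| ≤ (1 + ‖x + t • v‖)⁻¹ := fun t => by
    rw [abs_sub_comm]
    exact hfg _
  have hconst := hconv.eq_of_forall_le (M := 1) fun t =>
    (le_abs_self _).trans ((hle t).trans (inv_le_one_of_one_le₀ (by simp)))
  have hray : Tendsto (fun n : ℕ => ‖x + (n : ℝ) • v‖) atTop atTop := by
    have h1 : Tendsto (fun n : ℕ => (n : ℝ) * ‖v‖ + -‖x‖) atTop atTop :=
      tendsto_atTop_add_const_right _ _
        (tendsto_natCast_atTop_atTop.atTop_mul_const (norm_pos_iff.2 hv0))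
    refine tendsto_atTop_mono (fun n => ?_) h1
    have h2 := norm_sub_le (x + (n : ℝ) • v) x
    rw [add_sub_cancel_left, norm_smul, Real.norm_natCast] at h2
    linarith
  have hlim : Tendsto (fun n : ℕ => (1 + ‖x + (n : ℝ) • v‖)⁻¹) atTop (𝓝 0) :=
    (tendsto_atTop_add_const_left _ _ hray).inv_tendsto_atTop
  have h0 : |g x - f x| ≤ 0 := ge_of_tendsto' hlim fun n => by
    have h1 := hconst 0 n
    simp only [zero_smul, add_zero] at h1
    rw [h1]
    exact hle n
  linarith [abs_nonpos_iff.1 h0]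

end

theorem mainTheorem7 (d : ℕ) (hd : 2 ≤ d) (p : ℕ∞)
    (f : EuclideanSpace ℝ (Fin d) → ℝ)
    (hf : ConvexOn ℝ univ f)
    (hfp : ContDiff ℝ (p : WithTop ℕ∞) f)
    (hfp' : ¬ ContDiff ℝ (nextSmoothness p) f) :
    List.TFAE
      [ IsProperlyConvex f,
        ∃ (ℓ : EuclideanSpace ℝ (Fin d) →ₗ[ℝ] ℝ) (c : EuclideanSpace ℝ (Fin d) → ℝ),
          (∀ x, f x = ℓ x + c x) ∧
            Tendsto c (Bornology.cobounded (EuclideanSpace ℝ (Fin d))) atTop,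
        ¬ ∃ k : ℕ, k < d ∧
          ∃ (P : EuclideanSpace ℝ (Fin d) →ₗ[ℝ] EuclideanSpace ℝ (Fin k))
            (c : EuclideanSpace ℝ (Fin k) → ℝ) (ℓ : EuclideanSpace ℝ (Fin d) →ₗ[ℝ] ℝ),
            Function.Surjective P ∧ ConvexOn ℝ univ c ∧ ∀ x, f x = c (P x) + ℓ x,
        IsFinelyApproximableBy f {g | IsStronglyConvex g ∧ AnalyticOnNhd ℝ g univ},
        IsFinelyApproximableBy f
          {g | ConvexOn ℝ univ g ∧ ContDiff ℝ (nextSmoothness p) g} ] := by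
  have : NeZero d := ⟨by omega⟩
  tfae_have 1 → 2 := fun h => h.exists_coercive
  tfae_have 2 → 1 := fun ⟨_, _, hfc, hc⟩ => isProperlyConvex_of_coercive hf hfc hc
  tfae_have 3 → 2 := fun h => (exists_coercive_or_affine_direction hf).resolve_right
    fun ⟨_, _, hv, hα⟩ => h (exists_factorization_of_affine_direction hf hv hα)
  tfae_have 2 → 4 := fun ⟨_, _, hfc, hc⟩ =>
    isFinelyApproximableBy_analytic_of_coercive hf hfc hc
  tfae_have 4 → 5 := fun h ε hε hε0 => by
    obtain ⟨g, ⟨hg, hga⟩, hfg⟩ := h ε hε hε0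
    exact ⟨g, ⟨hg.convexOn hga.contDiff, hga.contDiff⟩, hfg⟩
  tfae_have 5 → 3 := by
    rintro h ⟨k, hk, P, c, ℓ, -, -, hfc⟩
    obtain ⟨g, ⟨hg, hgp⟩, hfg⟩ := h (fun x => (1 + ‖x‖)⁻¹)
      ((by fun_prop : Continuous fun x : EuclideanSpace ℝ (Fin d) => 1 + ‖x‖).inv₀
        fun x => by positivity) fun x => by positivity
    exact hfp' (eq_of_factorization_of_abs_sub_le hk hfc hg hfg ▸ hgp)
  tfae_finish
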